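/- Let $\mathbb{W} = \{(x,y)\in\mathbb{R}^2 : 0\le x<y\}$, and for $\mathbf{x}=(x,y)\in\mathbb{W}$ put $\mathsf{pers}(\mathbf{x}) = y-x$. A persistence diagram is a pair $D=(S,\mu)$ with $S\subset\mathbb{W}$ and $\mu:S\to\{1,2,\dots\}$ such that for every $\epsilon>0$ the sum of $\mu(\mathbf{x})$ over all $\mathbf{x}\in S$ with $\mathsf{pers}(\mathbf{x})>\epsilon$ is finite. Let $\mathcal{D}$ be the set of persistence diagrams, and let $D\sqcup D'$ denote the disjoint union of multisets (multiplicities add). For $D=(S,\mu)$ put $S_\mu=\{(\mathbf{x},k) : \mathbf{x}\in S,\ 1\le k\le\mu(\mathbf{x})\}$. For $\delta>0$, a $\delta$-matching between $(S,\mu)$ and $(T,\alpha)$ is a bijection between a subset of $S_\mu$ and a subset of $T_\alpha$ such that $\|\mathbf{x}-\mathbf{y}\|_\infty<\delta$ whenever $(\mathbf{x},k)$ is matched with $(\mathbf{y},n)$, and such that $\mathsf{pers}(\mathbf{z})<2\delta$ for every unmatched $(\mathbf{z},m)\in S_\mu$ or $(\mathbf{z},m)\in T_\alpha$. The space $\mathcal{D}$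 carries the topology of the bottleneck distance $$d_B(D,D')=\inf\{\delta>0 : \text{there is a } \delta\text{-matching between } D \text{ and } D'\}.$$ Let $C_c(\mathbb{W})$ be the space of continuous functions $\mathbb{W}\to\mathbb{R}$ with compact support. Let $K_1\subset K_2\subset\cdots$ be compact subsets of $\mathbb{W}$ with $\bigcup_n K_n=\mathbb{W}$, and let $C_c(K_n)=\{f\in C(\mathbb{W}) : \mathsf{supp}(f)\subset K_n\}$, with the sup norm. Endow $C_c(\mathbb{W})$ with the strict inductive limit topology, that is, the finest locally convex topology for which every inclusion $C_c(K_n)\hookrightarrow C_c(\mathbb{W})$ is continuous. Let $C_c(\mathbb{W})'$ be its topological dual, endowed with the weak-* topology, i.e. the weakest topology for which all evaluations $T\mapsto T(f)$, $f\in C_c(\mathbb{W})$, are continuous. **Theorem.** For $D=(S,\mu)\in\mathcal{D}$ and $f\in C_c(\mathbb{W})$ the sum $$\nu_D(f)=\sum_{\mathbf{x}\in S}\mu(\mathbf{x})f(\mathbf{x})$$ has only finitely many nonzero terms, and $\nu_D\in C_c(\mathbb{W})'$. The map $\nu:\mathcal{D}\to C_c(\mathbb{W})'$, $D\mapsto\nu_D$,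 is continuous and injective, and it satisfies $\nu(D\sqcup D')=\nu(D)+\nu(D')$ for all $D,D'\in\mathcal{D}$. -/

import Mathlib

open scoped ENNReal CompactlySupported

noncomputable section

/-- The wedge `{(x, y) ∈ ℝ² | 0 ≤ x < y}`. As a subtype of `ℝ × ℝ` it carries the subspace topology
and the distance induced by the sup norm `‖(x, y)‖ = max |x| |y|`. -/
abbrev Wedge : Type := {p : ℝ × ℝ // 0 ≤ p.1 ∧ p.1 < p.2}

/-- The persistence `y - x` of the point `(x, y)`. -/
def pers (x : Wedge) : ℝ := x.1.2 - x.1.1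

/-- The part of the wedge of persistence greater than `ε`. -/
def wedgeAbove (ε : ℝ) : Set Wedge := {x | ε < pers x}

/-- The total multiplicity in `U` of a multiplicity function `μ`, possibly infinite. -/
def totalMult (μ : Wedge → ℕ) (U : Set Wedge) : ℝ≥0∞ :=
  ∑' x : ↥({x | μ x ≠ 0} ∩ U), (μ x : ℝ≥0∞)

/-- A persistence diagram `(S, μ)`: a set `S` of points of the wedge with multiplicities
`μ : S → {1, 2, …}` such that the total multiplicity above each positive persistence level is
finite. The pair is recorded by the extension of `μ` by zero, and `S` is recovered as the set where
the extension does not vanish. -/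
@[ext]
structure Diagram where
  /-- The multiplicity function, extended by zero outside the underlying set. -/
  mult : Wedge → ℕ
  finite_mult : ∀ ε : ℝ, 0 < ε → totalMult mult (wedgeAbove ε) ≠ ∞

/-- Total multiplicity in `U` is finite exactly when `U` contains finitely many points. -/
theorem totalMult_ne_top_iff (μ : Wedge → ℕ) (U : Set Wedge) :
    totalMult μ U ≠ ∞ ↔ ({x | μ x ≠ 0} ∩ U).Finite := by
  constructor
  · intro h
    have h1 := ENNReal.finite_const_le_of_tsum_ne_top h one_ne_zero
    rw [← Set.finite_coe_iff, ← Set.finite_univ_iff]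
    refine h1.subset fun x _ => ?_
    have : 1 ≤ μ x := Nat.one_le_iff_ne_zero.2 x.2.1
    simpa using (by exact_mod_cast this : (1 : ℝ≥0∞) ≤ (μ x : ℝ≥0∞))
  · intro h
    have := h.fintype
    unfold totalMult
    rw [tsum_fintype]
    exact ENNReal.sum_ne_top.2 fun x _ => ENNReal.natCast_ne_top _

namespace Diagram

/-- The underlying set `S` of a diagram. -/
def carrier (D : Diagram) : Set Wedge := {x | D.mult x ≠ 0}

/-- The set `S_μ` of pairs `(x, k)` with `x ∈ S` and `1 ≤ k ≤ μ(x)`. -/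
def points (D : Diagram) : Set (Wedge × ℕ) :=
  {p | p.1 ∈ D.carrier ∧ 1 ≤ p.2 ∧ p.2 ≤ D.mult p.1}

/-- The disjoint union of two diagrams as multisets: multiplicities add. -/
def disjUnion (D D' : Diagram) : Diagram where
  mult x := D.mult x + D'.mult x
  finite_mult ε hε := by
    rw [totalMult_ne_top_iff]
    refine (((totalMult_ne_top_iff _ _).1 (D.finite_mult ε hε)).union
      ((totalMult_ne_top_iff _ _).1 (D'.finite_mult ε hε))).subset ?_
    rintro x ⟨hx, hU⟩
    by_cases h : D.mult x = 0
    · exact Or.inr ⟨fun h' => hx (by simp [h, h']), hU⟩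
    · exact Or.inl ⟨h, hU⟩

/-- There is a `δ`-matching between `D` and `D'`: a bijection `M` between a subset `A` of the points
of `D` and a subset `B` of the points of `D'` which moves every point by less than `δ` in the sup
norm and leaves unmatched only points of persistence less than `2δ`. -/
def HasMatching (δ : ℝ) (D D' : Diagram) : Prop :=
  ∃ A ⊆ D.points, ∃ B ⊆ D'.points, ∃ M : A ≃ B,
    (∀ p : A, ‖(p.1.1 : ℝ × ℝ) - ((M p).1.1 : ℝ × ℝ)‖ < δ) ∧
    (∀ z ∈ (D.points \ A) ∪ (D'.points \ B), pers z.1 < 2 * δ)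

/-- The bottleneck distance. -/
def bottleneck (D D' : Diagram) : ℝ := sInf {δ : ℝ | 0 < δ ∧ HasMatching δ D D'}

/-- The topology of the bottleneck distance: a set is open when it contains, around each of its
points, a ball of positive radius. -/
instance : TopologicalSpace Diagram where
  IsOpen U := ∀ D ∈ U, ∃ ε : ℝ, 0 < ε ∧ ∀ D', bottleneck D D' < ε → D' ∈ U
  isOpen_univ _ _ := ⟨1, one_pos, fun _ _ => trivial⟩
  isOpen_inter U V hU hV D hD := by
    obtain ⟨ε, hε, h⟩ := hU D hD.1
    obtain ⟨η, hη, h'⟩ := hV D hD.2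
    exact ⟨min ε η, lt_min hε hη, fun D' hD' =>
      ⟨h D' (hD'.trans_le (min_le_left _ _)), h' D' (hD'.trans_le (min_le_right _ _))⟩⟩
  isOpen_sUnion s hs D hD := by
    obtain ⟨U, hU, hDU⟩ := hD
    obtain ⟨ε, hε, h⟩ := hs U hU D hDU
    exact ⟨ε, hε, fun D' hD' => ⟨U, hU, h D' hD'⟩⟩

end Diagram

/-- The space of real continuous functions with compact support on the wedge. The parameter `K` only
serves to select the topology on it: the strict inductive limit topology along the sequence `K`. -/
def CcWedge (_K : ℕ → Set Wedge) : Type := C_c(Wedge, ℝ)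

namespace CcWedge

variable (K : ℕ → Set Wedge)

instance : AddCommGroup (CcWedge K) := inferInstanceAs (AddCommGroup C_c(Wedge, ℝ))

instance : Module ℝ (CcWedge K) := inferInstanceAs (Module ℝ C_c(Wedge, ℝ))

instance : FunLike (CcWedge K) Wedge ℝ := inferInstanceAs (FunLike C_c(Wedge, ℝ) Wedge ℝ)

/-- The continuous functions on the wedge whose support is contained in `K n`. (If `K n` is
compact, then every continuous function with support in `K n` has compact support.) -/
def SupportedIn (n : ℕ) : Type := {f : C_c(Wedge, ℝ) // tsupport f ⊆ K n}

/-- The topology of the sup norm on the functions supported in `K n`. -/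
instance (n : ℕ) : TopologicalSpace (SupportedIn K n) :=
  TopologicalSpace.induced
    (fun f => CompactlySupportedContinuousMap.toBoundedContinuousFunction f.1) inferInstance

/-- The inclusion of the functions supported in `K n`. -/
def incl (n : ℕ) (f : SupportedIn K n) : CcWedge K := f.1

/-- The locally convex vector space topologies for which all the inclusions are continuous. -/
def admissibleTopologies : Set (TopologicalSpace (CcWedge K)) :=
  {t | @IsTopologicalAddGroup (CcWedge K) t _ ∧ @ContinuousSMul ℝ (CcWedge K) _ _ t ∧
    @LocallyConvexSpace ℝ (CcWedge K) _ _ _ _ t ∧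
    ∀ n, @Continuous (SupportedIn K n) (CcWedge K) _ t (incl K n)}

/-- The strict inductive limit topology: the finest locally convex topology for which all the
inclusions are continuous (finer topologies are smaller in the order on topologies). -/
instance : TopologicalSpace (CcWedge K) := sInf (admissibleTopologies K)

/-- The strict inductive limit topology is itself one of the topologies over which the infimum is
taken, so it is indeed the finest one. -/
theorem isLeast_topology :
    IsLeast (admissibleTopologies K) (inferInstance : TopologicalSpace (CcWedge K)) :=
  ⟨⟨topologicalAddGroup_sInf fun _ h => h.1, continuousSMul_sInf fun _ h => h.2.1,
    .sInf fun _ h => h.2.2.1, fun n => continuous_sInf_rng.2 fun _ h => h.2.2.2 n⟩,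
    fun _ ht => sInf_le ht⟩

end CcWedge

end

open scoped CompactlySupported

/-! A compact subset of the wedge has persistence bounded below by some `c > 0`, so a test function
sees only finitely many points of a diagram. Continuity of `ν_D` is checked on each `K n`, where
`ν_D` is a fixed finite sum of evaluations; injectivity follows from bump functions (`exists_bump`).
Continuity of `ν` is pointwise in `f`, by the weak-* topology. For a `δ`-matching with `4 * δ ≤ c`,
`f` vanishes at unmatched points, and the matched pairs that contribute are bounded in number by a
count depending on `D` alone. Uniform continuity of `f` bounds each difference
(`abs_functional_sub_le`). -/

theorem continuous_pers : Continuous pers := by unfold pers; fun_prop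

theorem pers_pos (x : Wedge) : 0 < pers x := sub_pos.2 x.2.2

theorem abs_pers_sub_pers_le (x y : Wedge) :
    |pers x - pers y| ≤ 2 * ‖(x : ℝ × ℝ) - (y : ℝ × ℝ)‖ := by
  have h1 := norm_fst_le ((x : ℝ × ℝ) - (y : ℝ × ℝ))
  have h2 := norm_snd_le ((x : ℝ × ℝ) - (y : ℝ × ℝ))
  simp only [Real.norm_eq_abs, Prod.fst_sub, Prod.snd_sub, abs_le] at h1 h2
  rw [abs_le]
  unfold pers
  constructor <;> linarith

/-- Needed for Urysohn's lemma in `exists_bump`. -/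
instance : LocallyCompactSpace Wedge := by
  have h : IsLocallyClosed {p : ℝ × ℝ | 0 ≤ p.1 ∧ p.1 < p.2} :=
    (isClosed_le continuous_const continuous_fst).isLocallyClosed.inter
      (isOpen_lt continuous_fst continuous_snd).isLocallyClosed
  exact h.locallyCompactSpace

/-- A compact subset of the wedge stays away from the diagonal. -/
theorem IsCompact.exists_lt_pers {C : Set Wedge} (hC : IsCompact C) :
    ∃ c : ℝ, 0 < c ∧ ∀ x ∈ C, c < pers x := by
  rcases C.eq_empty_or_nonempty with rfl | hne
  · exact ⟨1, one_pos, by simp⟩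
  · obtain ⟨x, -, hx⟩ := hC.exists_isMinOn hne continuous_pers.continuousOn
    exact ⟨pers x / 2, half_pos (pers_pos x), fun y hy =>
      (half_lt_self (pers_pos x)).trans_le (hx hy)⟩

/-! ### Test functions and the inductive limit topology. -/

namespace CcWedge

variable {K : ℕ → Set Wedge}

theorem exists_lt_pers (f : CcWedge K) : ∃ c : ℝ, 0 < c ∧ ∀ x, f x ≠ 0 → c < pers x := by
  obtain ⟨c, hc, h⟩ := (CompactlySupportedContinuousMap.hasCompactSupport
    (show C_c(Wedge, ℝ) from f)).isCompact.exists_lt_pers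
  exact ⟨c, hc, fun x hx => h x (subset_tsupport _ hx)⟩

protected theorem uniformContinuous (f : CcWedge K) : UniformContinuous f :=
  (CompactlySupportedContinuousMap.hasCompactSupport
    (show C_c(Wedge, ℝ) from f)).uniformContinuous_of_continuous
      (map_continuous (show C_c(Wedge, ℝ) from f))

/-- A linear functional on `CcWedge K` is continuous if its restrictions to the functions supported
in each `K n` are. -/
theorem continuous_of_incl (φ : CcWedge K →ₗ[ℝ] ℝ) (h : ∀ n, Continuous (φ ∘ incl K n)) :
    Continuous φ := by
  rw [continuous_iff_le_induced]
  -- The topology pulled back along `φ` is itself admissible, hence coarser than the limit topology.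
  exact sInf_le ⟨topologicalAddGroup_induced φ, continuousSMul_induced φ, .induced φ,
    fun n => continuous_induced_rng.2 (h n)⟩

theorem continuous_incl_apply (n : ℕ) (x : Wedge) :
    Continuous fun f : SupportedIn K n => incl K n f x := by
  have h : Continuous fun f : SupportedIn K n =>
      CompactlySupportedContinuousMap.toBoundedContinuousFunction f.1 := continuous_induced_dom
  exact (continuous_eval_const (F := BoundedContinuousFunction Wedge ℝ) x).comp h

end CcWedge

/-! ### The functional of a diagram. -/

namespace Diagram

variable {K : ℕ → Set Wedge}

theorem finite_carrier_inter (D : Diagram) {c : ℝ} (hc : 0 < c) :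
    {x ∈ D.carrier | c < pers x}.Finite :=
  (totalMult_ne_top_iff _ _).1 (D.finite_mult c hc)

theorem finite_points_inter (D : Diagram) {c : ℝ} (hc : 0 < c) :
    {p ∈ D.points | c < pers p.1}.Finite := by
  refine ((D.finite_carrier_inter hc).biUnion fun x _ =>
    (Set.finite_singleton x).prod (Set.finite_Icc 1 (D.mult x))).subset ?_
  rintro ⟨x, k⟩ ⟨⟨hx, hk⟩, hp⟩
  exact Set.mem_biUnion (x := x) ⟨hx, hp⟩ ⟨rfl, hk⟩

theorem finite_carrier_support (D : Diagram) (f : CcWedge K) :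
    {x ∈ D.carrier | f x ≠ 0}.Finite := by
  obtain ⟨c, hc, h⟩ := f.exists_lt_pers
  exact (D.finite_carrier_inter hc).subset fun x hx => ⟨hx.1, h x hx.2⟩

theorem finsum_carrier_eq (D : Diagram) (f : Wedge → ℝ) :
    ∑ᶠ x ∈ D.carrier, (D.mult x : ℝ) * f x = ∑ᶠ x, (D.mult x : ℝ) * f x := by
  refine finsum_congr fun x => ?_
  by_cases h : D.mult x = 0 <;> simp [carrier, h]

theorem finite_support_mult_mul (D : Diagram) (f : CcWedge K) :
    (Function.support fun x => (D.mult x : ℝ) * f x).Finite :=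
  (D.finite_carrier_support f).subset fun x hx => by
    simpa [carrier] using hx

/-- Matchings act on copies `(x, k)`, whereas the functional weights points by multiplicity. -/
theorem finsum_points_eq (D : Diagram) (f : CcWedge K) :
    ∑ᶠ p ∈ D.points, f p.1 = ∑ᶠ x, (D.mult x : ℝ) * f x := by
  obtain ⟨c, hc, h⟩ := f.exists_lt_pers
  rw [finsum_mem_def, finsum_curry]
  · refine finsum_congr fun x => ?_
    have : ∀ k, D.points.indicator (fun p => f p.1) (x, k) =
        (Set.Icc 1 (D.mult x)).indicator (fun _ => f x) k := fun k => by
      refine Set.indicator_eq_indicator ?_ rfl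
      simp only [points, carrier, Set.mem_ofPred_eq, Set.mem_Icc]
      omega
    simp_rw [this]
    rw [← finsum_mem_def, ← Finset.coe_Icc, finsum_mem_coe_finset]
    simp
  · refine (D.finite_points_inter hc).subset fun p hp => ?_
    rw [Set.support_indicator] at hp
    exact ⟨hp.1, h _ hp.2⟩

/-- The linear functional `f ↦ ∑ μ(x) f(x)` associated with a diagram `(S, μ)`. -/
noncomputable def functional (K : ℕ → Set Wedge) (D : Diagram) : CcWedge K →ₗ[ℝ] ℝ where
  toFun f := ∑ᶠ x, (D.mult x : ℝ) * f x
  map_add' f g := by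
    rw [← finsum_add_distrib (D.finite_support_mult_mul f) (D.finite_support_mult_mul g)]
    exact finsum_congr fun x => mul_add _ _ _
  map_smul' r f := by
    rw [RingHom.id_apply, smul_eq_mul, mul_finsum]
    exact finsum_congr fun x => mul_left_comm _ _ _

theorem functional_apply (D : Diagram) (f : CcWedge K) :
    D.functional K f = ∑ᶠ x, (D.mult x : ℝ) * f x := rfl

theorem continuous_functional (hK : ∀ n, IsCompact (K n)) (D : Diagram) :
    Continuous (D.functional K) := by
  refine CcWedge.continuous_of_incl _ fun n => ?_
  obtain ⟨c, hc, h⟩ := (hK n).exists_lt_pers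
  -- The index set depends on `n` only, not on `f`.
  have key : ∀ f : CcWedge.SupportedIn K n, D.functional K (CcWedge.incl K n f) =
      ∑ x ∈ (D.finite_carrier_inter hc).toFinset, (D.mult x : ℝ) * CcWedge.incl K n f x := by
    intro f
    refine finsum_eq_sum_of_support_subset _ fun x hx => ?_
    rw [Function.mem_support, mul_ne_zero_iff, Nat.cast_ne_zero] at hx
    rw [Set.Finite.coe_toFinset]
    exact ⟨hx.1, h x (f.2 (subset_tsupport _ hx.2))⟩
  refine (continuous_congr key).2 ?_
  exact continuous_finsetSum _ fun x _ =>
    continuous_const.mul (CcWedge.continuous_incl_apply n x)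

theorem functional_disjUnion (D D' : Diagram) :
    (D.disjUnion D').functional K = D.functional K + D'.functional K := by
  ext f
  rw [LinearMap.add_apply, functional_apply, functional_apply, functional_apply,
    ← finsum_add_distrib (D.finite_support_mult_mul f) (D'.finite_support_mult_mul f)]
  refine finsum_congr fun x => ?_
  simp [disjUnion, add_mul]

/-- Near a given point there is a test function which isolates it in a given diagram. -/
theorem exists_bump (D D' : Diagram) (x : Wedge) :
    ∃ f : CcWedge K, f x = 1 ∧ ∀ y ≠ x, y ∈ D.carrier ∪ D'.carrier → f y = 0 := by
  have hc : 0 < pers x / 2 := half_pos (pers_pos x)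
  -- Finite, hence closed; the diagram points left out, other than `x`, lie in the closed
  -- low-persistence region.
  set F := ({y ∈ D.carrier | pers x / 2 < pers y} ∪ {y ∈ D'.carrier | pers x / 2 < pers y}) \ {x}
  have hF : F.Finite :=
    ((D.finite_carrier_inter hc).union (D'.finite_carrier_inter hc)).subset Set.sdiff_subset
  have ht : IsClosed ({y | pers y ≤ pers x / 2} ∪ F) :=
    (isClosed_le continuous_pers continuous_const).union hF.isClosed
  obtain ⟨f, hf1, hf0, hfc, -⟩ := exists_continuous_one_zero_of_isCompact
    (isCompact_singleton (x := x)) ht (by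
      rw [Set.disjoint_singleton_left]
      rintro (h | h)
      · exact absurd h (not_le.2 (half_lt_self (pers_pos x)))
      · exact h.2 rfl)
  refine ⟨(⟨f, hfc⟩ : C_c(Wedge, ℝ)), hf1 rfl, fun y hyx hy => hf0 ?_⟩
  rcases le_or_gt (pers y) (pers x / 2) with h | h
  · exact Or.inl h
  · exact Or.inr ⟨hy.imp (fun hy => ⟨hy, h⟩) (fun hy => ⟨hy, h⟩), hyx⟩

theorem functional_injective : Function.Injective (functional K) := by
  intro D D' h
  ext x
  obtain ⟨f, hx, hf⟩ := exists_bump (K := K) D D' x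
  have key : ∀ E : Diagram, E.carrier ⊆ D.carrier ∪ D'.carrier →
      E.functional K f = E.mult x := by
    intro E hE
    rw [functional_apply, finsum_eq_single _ x, hx, mul_one]
    intro y hy
    by_cases hy' : y ∈ E.carrier
    · rw [hf y hy (hE hy'), mul_zero]
    · rw [show E.mult y = 0 from not_not.1 hy', Nat.cast_zero, zero_mul]
  have h1 := key D Set.subset_union_left
  rw [h, key D' Set.subset_union_right] at h1
  exact_mod_cast h1.symm

/-! ### Continuity in the bottleneck distance. -/

theorem exists_hasMatching (D D' : Diagram) : ∃ δ : ℝ, 0 < δ ∧ HasMatching δ D D' := by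
  have bdd : ∀ E : Diagram, ∃ b : ℝ, 1 ≤ b ∧ ∀ x ∈ E.carrier, pers x ≤ b := by
    intro E
    obtain ⟨b, hb⟩ := ((E.finite_carrier_inter one_pos).image pers).bddAbove
    refine ⟨max 1 b, le_max_left _ _, fun x hx => ?_⟩
    rcases le_or_gt (pers x) 1 with h | h
    · exact h.trans (le_max_left _ _)
    · exact (hb ⟨x, ⟨hx, h⟩, rfl⟩).trans (le_max_right _ _)
  obtain ⟨b, hb1, hb⟩ := bdd D
  obtain ⟨b', hb1', hb'⟩ := bdd D'
  -- The empty matching works once `2 * δ` exceeds every persistence; it keeps the infimum from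
  -- being the default `sInf ∅ = 0`.
  refine ⟨b + b', by linarith, ∅, Set.empty_subset _, ∅, Set.empty_subset _, Equiv.refl _,
    fun p => p.2.elim, ?_⟩
  rintro z (hz | hz)
  · linarith [hb _ hz.1.1]
  · linarith [hb' _ hz.1.1]

theorem exists_hasMatching_of_bottleneck_lt {D D' : Diagram} {ε : ℝ} (h : bottleneck D D' < ε) :
    ∃ δ : ℝ, 0 < δ ∧ δ < ε ∧ HasMatching δ D D' := by
  obtain ⟨δ, ⟨hδ, hM⟩, hlt⟩ := exists_lt_of_csInf_lt (exists_hasMatching D D') h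
  exact ⟨δ, hδ, hlt, hM⟩

theorem abs_functional_sub_le {D D' : Diagram} {f : CcWedge K} {c δ η : ℝ} (hc : 0 < c)
    (hf : ∀ x, f x ≠ 0 → c < pers x) (hδc : 4 * δ ≤ c) (hη : 0 ≤ η)
    (hfδ : ∀ x y : Wedge, dist x y < δ → dist (f x) (f y) ≤ η) (hM : HasMatching δ D D') :
    |D.functional K f - D'.functional K f| ≤ {p ∈ D.points | c / 2 < pers p.1}.ncard * η := by
  obtain ⟨A, hA, B, hB, M, hAB, hun⟩ := hM
  have hdist : ∀ p : A, dist p.1.1 (M p).1.1 < δ := fun p => by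
    rw [Subtype.dist_eq, dist_eq_norm]
    exact hAB p
  have hzero : ∀ z ∈ (D.points \ A) ∪ (D'.points \ B), f z.1 = 0 := fun z hz => by
    by_contra h
    linarith [hun z hz, hf _ h, pers_pos z.1]
  have hDA : D.functional K f = ∑ᶠ a : A, f a.1.1 := by
    rw [functional_apply, ← finsum_points_eq,
      finsum_set_coe_eq_finsum_mem (f := fun p : Wedge × ℕ => f p.1)]
    refine finsum_mem_inter_support_eq' _ _ _ fun p hp => ⟨fun h => ?_, fun h => hA h⟩
    by_contra h'
    exact hp (hzero p (Or.inl ⟨h, h'⟩))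
  have hDB : D'.functional K f = ∑ᶠ a : A, f (M a).1.1 := by
    rw [functional_apply, ← finsum_points_eq, finsum_comp_equiv M (f := fun b : B => f b.1.1),
      finsum_set_coe_eq_finsum_mem (f := fun p : Wedge × ℕ => f p.1)]
    refine finsum_mem_inter_support_eq' _ _ _ fun p hp => ⟨fun h => ?_, fun h => hB h⟩
    by_contra h'
    exact hp (hzero p (Or.inr ⟨h, h'⟩))
  have hfin := D.finite_points_inter (half_pos hc)
  have hG : {a : A | c / 2 < pers a.1.1}.Finite :=
    (hfin.preimage Subtype.val_injective.injOn).subset fun a ha => ⟨hA a.2, ha⟩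
  have hcard : hG.toFinset.card ≤ {p ∈ D.points | c / 2 < pers p.1}.ncard := by
    rw [Set.ncard_eq_toFinset_card _ hfin]
    refine Finset.card_le_card_of_injOn Subtype.val (fun a ha => ?_) Subtype.val_injective.injOn
    simp only [Set.Finite.coe_toFinset] at ha ⊢
    exact ⟨hA a.2, ha⟩
  rw [hDA, hDB, finsum_eq_sum_of_support_subset (s := hG.toFinset) _ fun a ha => ?_,
    finsum_eq_sum_of_support_subset (s := hG.toFinset) _ fun a ha => ?_,
    ← Finset.sum_sub_distrib]
  · calc |∑ a ∈ hG.toFinset, (f a.1.1 - f (M a).1.1)|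
        ≤ ∑ a ∈ hG.toFinset, |f a.1.1 - f (M a).1.1| := Finset.abs_sum_le_sum_abs _ _
      _ ≤ hG.toFinset.card • η := Finset.sum_le_card_nsmul _ _ _ fun a _ => hfδ _ _ (hdist a)
      _ ≤ _ := by rw [nsmul_eq_mul]; gcongr
  · rw [Set.Finite.coe_toFinset]
    -- Matching changes persistence by less than `2 * δ ≤ c / 2`, so a partner above `c` forces the
    -- point of `D` above `c / 2`.
    have h1 := hf _ ha
    have h2 := (abs_le.1 (abs_pers_sub_pers_le a.1.1 (M a).1.1)).1
    have h3 := hAB a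
    show c / 2 < pers a.1.1
    linarith
  · rw [Set.Finite.coe_toFinset]
    exact (half_lt_self hc).trans (hf _ ha)

theorem continuous_functional_apply (f : CcWedge K) :
    Continuous fun D : Diagram => D.functional K f := by
  refine ⟨fun U hU D hD => ?_⟩
  obtain ⟨r, hr, hball⟩ := Metric.isOpen_iff.1 hU _ hD
  obtain ⟨c, hc, hf⟩ := f.exists_lt_pers
  set N := {p ∈ D.points | c / 2 < pers p.1}.ncard
  -- The `+ 1` covers `N = 0` and makes `N * η < r` strict.
  have hη : 0 < r / (N + 1) := by positivity
  obtain ⟨ε, hε, hfε⟩ := Metric.uniformContinuous_iff.1 f.uniformContinuous _ hη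
  refine ⟨min ε (c / 4), lt_min hε (by linarith), fun D' hD' => hball ?_⟩
  obtain ⟨δ, -, hδ, hM⟩ := exists_hasMatching_of_bottleneck_lt hD'
  have h := abs_functional_sub_le hc hf (by linarith [hδ.trans_le (min_le_right _ _)]) hη.le
    (fun x y hxy => (hfε (hxy.trans (hδ.trans_le (min_le_left _ _)))).le) hM
  rw [Metric.mem_ball', Real.dist_eq]
  refine h.trans_lt ?_
  rw [mul_div_assoc', div_lt_iff₀ (by positivity)]
  linarith

end Diagram

theorem mainTheorem6 (K : ℕ → Set Wedge) (hK_compact : ∀ n, IsCompact (K n))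
    (hK_mono : ∀ n, K n ⊆ K (n + 1)) (hK_union : ⋃ n, K n = Set.univ) :
    ∃ ν : Diagram → WeakDual ℝ (CcWedge K),
      (∀ (D : Diagram) (f : CcWedge K),
        {x ∈ D.carrier | f x ≠ 0}.Finite ∧
          ν D f = ∑ᶠ x ∈ D.carrier, (D.mult x : ℝ) * f x) ∧
      Continuous ν ∧ Function.Injective ν ∧
      ∀ D D' : Diagram, ν (D.disjUnion D') = ν D + ν D' := by
  refine ⟨fun D => ⟨D.functional K, D.continuous_functional hK_compact⟩, fun D f =>
    ⟨D.finite_carrier_support f, (D.finsum_carrier_eq f).symm⟩,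
    WeakDual.continuous_of_continuous_eval Diagram.continuous_functional_apply,
    fun D D' h => Diagram.functional_injective (K := K) ?_, fun D D' => ?_⟩
  · exact LinearMap.ext fun f => DFunLike.congr_fun h f
  · exact DFunLike.ext _ _ fun f => DFunLike.congr_fun (Diagram.functional_disjUnion D D') f
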